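/- For an integer $m\ge 0$ let $\mathbb{P}^m_{\mathbb{C}}=(\mathbb{C}^{m+1}\setminus\{0\})/\mathbb{C}^*$, with the quotient topology, and let $PSL_{m+1}(\mathbb{C})$, the quotient of $SL_{m+1}(\mathbb{C})$ by its center (the scalar matrices $\alpha I$ with $\alpha^{m+1}=1$), act on it by projective transformations. A subgroup $\Gamma\le PSL_{m+1}(\mathbb{C})$ is called a Schottky group acting on $\mathbb{P}^m_{\mathbb{C}}$ if, for some integer $g\ge 2$, 1. there are $2g$ open sets $R_1,\dots,R_g,S_1,\dots,S_g$ in $\mathbb{P}^m_{\mathbb{C}}$, each of which is the interior of its closure, and whose closures are pairwise disjoint; and 2. $\Gamma$ is generated by elements $\gamma_1,\dots,\gamma_g$ such that $\gamma_j(R_j)=\mathbb{P}^m_{\mathbb{C}}\setminus\overline{S_j}$ for all $1\le j\le g$. **Theorem.** Let $n\ge 0$ be an integer. If $\Gamma\le PSL_{2n+1}(\mathbb{C})$ is a discrete subgroup, then $\Gamma$ is not a Schottky group acting on $\mathbb{P}^{2n}_{\mathbb{C}}$. -/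

import Mathlib

open scoped LinearAlgebra.Projectivization MatrixGroups

/-- The complex projective space `ℙ^m`: lines through the origin of `ℂ^(m+1)`. -/
abbrev CProj (m : ℕ) : Type := ℙ ℂ (Fin (m + 1) → ℂ)

/-- The topology of `ℙ^m`: the quotient topology for the projection `v ↦ [v]` from
`ℂ^(m+1) ∖ {0}`. -/
noncomputable instance CProj.instTopologicalSpace (m : ℕ) : TopologicalSpace (CProj m) :=
  TopologicalSpace.coinduced
    (fun v : {v : Fin (m + 1) → ℂ // v ≠ 0} => Projectivization.mk ℂ v.1 v.2) inferInstance

/-- A subgroup `Γ` of `PSL(m + 1, ℂ)` is a Schottky group acting on `ℙ^m` if, for some `g ≥ 2`,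
there are `2 g` open sets `R_1, …, R_g, S_1, …, S_g` of `ℙ^m`, each of them the interior of its
closure and with pairwise disjoint closures, and generators `γ_1, …, γ_g` of `Γ` such that
`γ_j` maps `R_j` onto the complement of the closure of `S_j`. -/
def IsSchottky {m : ℕ} (Γ : Subgroup PSL(m + 1, ℂ)) : Prop :=
  ∃ g : ℕ, 2 ≤ g ∧ ∃ (R S : Fin g → Set (CProj m)) (γ : Fin g → PSL(m + 1, ℂ)),
    (∀ j, IsOpen (R j)) ∧ (∀ j, IsOpen (S j)) ∧
    (∀ j, interior (closure (R j)) = R j) ∧ (∀ j, interior (closure (S j)) = S j) ∧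
    (∀ i j, i ≠ j → Disjoint (closure (R i)) (closure (R j))) ∧
    (∀ i j, i ≠ j → Disjoint (closure (S i)) (closure (S j))) ∧
    (∀ i j, Disjoint (closure (R i)) (closure (S j))) ∧
    Subgroup.closure (Set.range γ) = Γ ∧
    ∀ j, (fun x : CProj m => γ j • x) '' R j = (closure (S j))ᶜ


/-!
Let `γ` map `R` onto the complement of `closure S`, where `closure R` and `closure S` are disjoint.
A linear lift of `γ` then maps the closed cone over the complement of `R` into the open cone over
the complement of `closure R`. This is an open condition on the lift, so the lift may be perturbed
to have a basis of eigenvectors whose eigenvalues are nonzero and of pairwise distinct moduli.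
Iterating the perturbed map forwards and backwards, a vector converges projectively to an
eigenvector, which shows that `ℂ^(m+1)` is the direct sum of a subspace avoiding `closure R` and
one inside `R`. Applying the lift to the former, we get linear subspaces `ℙ(U) ⊆ closure S` and
`ℙ(W) ⊆ R` with `dim U + dim W = m + 1`.

For two generators, disjointness gives `dim U + dim U'`, `dim W + dim W'`, `dim U + dim W'`,
`dim U' + dim W ≤ m + 1`. Hence all four dimensions are equal, and `m + 1` is even.
-/

open Filter Function Module Set Topology

section Triangularization

variable {K V : Type*} [Field K] [AddCommGroup V] [Module K V]

theorem exists_dual_ker_le_comap_ker [IsAlgClosed K] [FiniteDimensional K V] [Nontrivial V]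
    (f : End K V) : ∃ φ : Dual K V, φ ≠ 0 ∧ LinearMap.ker φ ≤ (LinearMap.ker φ).comap f := by
  obtain ⟨μ, hμ⟩ := f.exists_eigenvalue
  have hrange : LinearMap.range (f - algebraMap K (End K V) μ) < ⊤ := by
    rw [lt_top_iff_ne_top, Ne, ← LinearMap.ker_eq_bot_iff_range_eq_top]
    simpa [End.hasEigenvalue_iff, End.eigenspace_def, Algebra.algebraMap_eq_smul_one] using hμ
  obtain ⟨φ, hφ, hle⟩ := Submodule.exists_le_ker_of_lt_top _ hrange
  have hφf (x : V) : φ (f x) = μ * φ x := by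
    simpa [sub_eq_zero] using hle (LinearMap.mem_range_self _ x)
  exact ⟨φ, hφ, fun x hx => by simp_all⟩

theorem exists_basis_castSucc_eq {φ : Dual K V} (hφ : φ ≠ 0) {n : ℕ}
    (b : Basis (Fin n) K (LinearMap.ker φ)) :
    ∃ b' : Basis (Fin (n + 1)) K V, ∀ i : Fin n, b' i.castSucc = b i := by
  obtain ⟨w, hw⟩ : ∃ w, φ w = 1 := LinearMap.surjective hφ 1
  refine ⟨.mkFinSnoc b w (fun c x hx hcx => ?_) fun z => ⟨-φ z, ?_⟩, fun i => by simp⟩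
  · simpa [hw, LinearMap.mem_ker.1 hx] using congrArg φ hcx
  · simp [hw]

theorem exists_basis_forall_apply_mem_flag [IsAlgClosed K] {n : ℕ} [FiniteDimensional K V]
    (hn : finrank K V = n) (f : End K V) :
    ∃ b : Basis (Fin n) K V, ∀ i, f (b i) ∈ b.flag i.succ := by
  induction n generalizing V with
  | zero => exact ⟨finBasisOfFinrankEq K V hn, Fin.rec0⟩
  | succ n ih =>
    have : Nontrivial V := nontrivial_of_finrank_pos (R := K) (by lia)
    obtain ⟨φ, hφ, hinv⟩ := exists_dual_ker_le_comap_ker f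
    have hker : finrank K (LinearMap.ker φ) = n := by
      have := Dual.finrank_ker_add_one_of_ne_zero hφ
      lia
    obtain ⟨b, hb⟩ := ih hker (f.restrict hinv)
    obtain ⟨b', hb'⟩ := exists_basis_castSucc_eq hφ b
    have hflag (k : Fin (n + 1)) : b.flag k ≤
        (b'.flag k.castSucc).comap (LinearMap.ker φ).subtype :=
      b.flag_le_iff.2 fun i hi => by simpa [← hb'] using hi
    refine ⟨b', Fin.lastCases (by simp) fun i => ?_⟩
    simpa [hb'] using hflag _ (hb i)

theorem hasEigenvalue_repr_of_forall_apply_mem_flag {n : ℕ} {b : Basis (Fin n) K V} {f : End K V}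
    (hf : ∀ i, f (b i) ∈ b.flag i.succ) (i : Fin n) : f.HasEigenvalue (b.repr (f (b i)) i) := by
  have := b.finiteDimensional_of_finite
  have hM : (LinearMap.toMatrix b b f).IsUpperTriangular := fun i j hij => by
    rw [LinearMap.toMatrix_apply]
    exact b.flag_le_ker_coord (Fin.succ_le_castSucc_iff.2 hij) (hf j)
  rw [End.hasEigenvalue_iff_isRoot_charpoly, ← f.charpoly_toMatrix b,
    Matrix.charpoly_of_isUpperTriangular _ hM, Polynomial.IsRoot, Polynomial.eval_prod]
  exact Finset.prod_eq_zero (Finset.mem_univ i) (by simp [LinearMap.toMatrix_apply])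

theorem exists_forall_hasEigenvalue_add_smul [IsAlgClosed K] [FiniteDimensional K V]
    (f : End K V) :
    ∃ a : Fin (finrank K V) → K, ∀ d : Fin (finrank K V) → K, ∃ D : End K V,
      ∀ (t : K) (i : Fin (finrank K V)), (f + t • D).HasEigenvalue (a i + t * d i) := by
  obtain ⟨b, hb⟩ := exists_basis_forall_apply_mem_flag rfl f
  -- Adding a map diagonal in the triangularizing basis only shifts the diagonal coefficients.
  refine ⟨fun i => b.repr (f (b i)) i, fun d => ⟨b.constr K fun i => d i • b i, fun t i => ?_⟩⟩
  convert hasEigenvalue_repr_of_forall_apply_mem_flag (b := b) (fun i => ?_) i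
  · simp
  · simpa [smul_smul] using add_mem (hb i) (Submodule.smul_mem _ (t * d i) (by simp))

theorem exists_basis_hasEigenvector {ι : Type*} [Fintype ι] [FiniteDimensional K V] {f : End K V}
    {l : ι → K} (hι : Fintype.card ι = finrank K V) (hl : Injective l)
    (hf : ∀ i, f.HasEigenvalue (l i)) :
    ∃ e : Basis ι K V, ∀ i, f.HasEigenvector (l i) (e i) := by
  choose v hv using fun i => (hf i).exists_hasEigenvector
  exact ⟨basisOfLinearIndependentOfCardEqFinrank'
    v (End.eigenvectors_linearIndependent' f l hl v hv) hι, by simpa using hv⟩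

end Triangularization

theorem eventually_injective_add_mul {ι K : Type*} [Finite ι] [Field K] [TopologicalSpace K]
    [T1Space K] (a : ι → K) {d : ι → K} (hd : Injective d) (t₀ : K) :
    ∀ᶠ t in 𝓝[≠] t₀, Injective fun i => a i + t * d i := by
  have hcross : ∀ᶠ t in 𝓝[≠] t₀, ∀ i j, i ≠ j → t ≠ (a i - a j) / (d j - d i) :=
    eventually_all.2 fun i => eventually_all.2 fun j => eventually_imp_distrib_left.2 fun _ =>
      nhdsNE_le_cofinite t₀ (eventually_cofinite_ne _)
  filter_upwards [hcross] with t ht i j h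
  by_contra hij
  have hne : d j - d i ≠ 0 := sub_ne_zero.2 (hd.ne (Ne.symm hij))
  refine ht i j hij ((eq_div_iff hne).2 ?_)
  linear_combination -h

theorem exists_forall_norm_add_smul_eq {E : Type*} [NormedAddCommGroup E] [NormedSpace ℝ E]
    [Nontrivial E] (a : E) : ∃ u : E, ∀ t : ℝ, 0 ≤ t → ‖a + t • u‖ = ‖a‖ + t := by
  obtain rfl | ha := eq_or_ne a 0
  · obtain ⟨u, hu⟩ := exists_norm_eq E zero_le_one
    exact ⟨u, fun t ht => by simp [norm_smul, hu, abs_of_nonneg ht]⟩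
  · refine ⟨‖a‖⁻¹ • a, fun t ht => ?_⟩
    have hray : SameRay ℝ a (t • ‖a‖⁻¹ • a) :=
      ((SameRay.refl a).nonneg_smul_right (by positivity)).nonneg_smul_right ht
    rw [hray.norm_add, norm_smul, norm_smul]
    simp [ha, abs_of_nonneg ht]

/-- `e` is a basis of eigenvectors of `f` whose eigenvalues `l i` are nonzero and have pairwise
distinct norms. Such an `f` acts on projective space as a strongly loxodromic transformation: the
orbit of every line converges to one of the lines spanned by the `e i`. -/
structure IsLoxodromicBasis {ι 𝕜 V : Type*} [NormedField 𝕜] [AddCommGroup V] [Module 𝕜 V]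
    (f : End 𝕜 V) (e : Basis ι 𝕜 V) (l : ι → 𝕜) : Prop where
  apply_eq : ∀ i, f (e i) = l i • e i
  ne_zero : ∀ i, l i ≠ 0
  injective_norm : Injective fun i => ‖l i‖

/-- Sets invariant under nonzero scalars. With `0` removed, these are the preimages in `V` of the
subsets of the projective space of `V`. -/
def IsScaleInvariant (𝕜 : Type*) {V : Type*} [Zero 𝕜] [SMul 𝕜 V] (X : Set V) : Prop :=
  ∀ ⦃c : 𝕜⦄, c ≠ 0 → ∀ v, c • v ∈ X ↔ v ∈ X

theorem IsScaleInvariant.compl {𝕜 V : Type*} [Zero 𝕜] [SMul 𝕜 V] {X : Set V}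
    (hX : IsScaleInvariant 𝕜 X) : IsScaleInvariant 𝕜 Xᶜ :=
  fun _ hc v => not_congr (hX hc v)

theorem isCompl_span_image {ι K V : Type*} [Field K] [AddCommGroup V] [Module K V]
    (e : Basis ι K V) (J : Set ι) :
    IsCompl (Submodule.span K (e '' J)) (Submodule.span K (e '' Jᶜ)) where
  disjoint := e.linearIndependent.disjoint_span_image disjoint_compl_right
  codisjoint := by
    rw [codisjoint_iff, ← Submodule.span_union, ← image_union, union_compl_self, image_univ,
      e.span_eq]

section Dynamics

variable {ι 𝕜 V : Type*} [NormedField 𝕜] [AddCommGroup V] [Module 𝕜 V]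
  {f : End 𝕜 V} {e : Basis ι 𝕜 V} {l : ι → 𝕜}

theorem tendsto_inv_pow_smul_pow_apply [Finite ι] [TopologicalSpace V] [ContinuousAdd V]
    [ContinuousSMul 𝕜 V] (hf : ∀ i, f (e i) = l i • e i) {x : V} {i : ι} (hi : l i ≠ 0)
    (hmax : ∀ j, j ≠ i → e.repr x j ≠ 0 → ‖l j‖ < ‖l i‖) :
    Tendsto (fun k : ℕ => (l i)⁻¹ ^ k • (f ^ k) x) atTop (𝓝 (e.repr x i • e i)) := by
  classical
  have := Fintype.ofFinite ι
  have hpow (k : ℕ) (j : ι) : (f ^ k) (e j) = l j ^ k • e j :=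
    End.HasEigenvector.pow_apply ⟨End.mem_eigenspace_iff.2 (hf j), e.ne_zero j⟩ k
  have hsum (k : ℕ) :
      (l i)⁻¹ ^ k • (f ^ k) x = ∑ j, ((l j / l i) ^ k * e.repr x j) • e j := by
    conv_lhs => rw [← e.sum_repr x]
    simp only [map_sum, map_smul, hpow, Finset.smul_sum, smul_smul]
    exact Finset.sum_congr rfl fun j _ => by ring_nf
  have hlim : e.repr x i • e i = ∑ j, (if j = i then e.repr x i else 0) • e j := by
    simp [ite_smul]
  simp only [hsum]
  rw [hlim]
  refine tendsto_finsetSum _ fun j _ => Tendsto.smul_const ?_ _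
  obtain rfl | hji := eq_or_ne j i
  · simp [hi]
  obtain hj | hj := eq_or_ne (e.repr x j) 0
  · simp [hj, hji]
  have hlt : ‖l j / l i‖ < 1 := by
    rw [norm_div, div_lt_one (norm_pos_iff.2 hi)]
    exact hmax j hji hj
  simpa [hji] using (tendsto_pow_atTop_nhds_zero_of_norm_lt_one hlt).mul_const (e.repr x j)

namespace IsLoxodromicBasis

theorem exists_comp_eq_id (hf : IsLoxodromicBasis f e l) :
    ∃ g : End 𝕜 V, IsLoxodromicBasis g e l⁻¹ ∧ f ∘ₗ g = LinearMap.id := by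
  refine ⟨e.constr 𝕜 fun i => (l i)⁻¹ • e i, ⟨fun i => by simp, fun i => by simp [hf.ne_zero i],
    fun i j hij => hf.injective_norm (by simpa using hij)⟩, e.ext fun i => ?_⟩
  simp [hf.apply_eq, smul_smul, hf.ne_zero i]

theorem exists_mem_of_mem_span_image [Finite ι] [TopologicalSpace V] [ContinuousAdd V]
    [ContinuousSMul 𝕜 V] (hf : IsLoxodromicBasis f e l) {C : Set V} (hC : IsClosed C)
    (hCs : IsScaleInvariant 𝕜 C) (hfC : MapsTo f C C) {J : Set ι} {x : V}
    (hxJ : x ∈ Submodule.span 𝕜 (e '' J)) (hxC : x ∈ C) (hx : x ≠ 0) : ∃ j ∈ J, e j ∈ C := by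
  rw [e.mem_span_image] at hxJ
  have hsupp : (e.repr x).support.Nonempty := by simpa [Finsupp.support_nonempty_iff] using hx
  obtain ⟨i, hi, hmax⟩ := Finset.exists_max_image _ (fun i => ‖l i‖) hsupp
  have hlim := tendsto_inv_pow_smul_pow_apply hf.apply_eq (x := x) (hf.ne_zero i) fun j hji hj =>
    (hmax j (by simpa using hj)).lt_of_ne (hf.injective_norm.ne hji)
  have horbit (k : ℕ) : (l i)⁻¹ ^ k • (f ^ k) x ∈ C := by
    rw [hCs (pow_ne_zero k (inv_ne_zero (hf.ne_zero i))), End.pow_apply]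
    exact hfC.iterate k hxC
  exact ⟨i, hxJ hi, (hCs (by simpa using hi) _).1 (hC.mem_of_tendsto hlim (.of_forall horbit))⟩

theorem exists_isCompl_forall_mem [Finite ι] [TopologicalSpace V] [ContinuousAdd V]
    [ContinuousSMul 𝕜 V] (hf : IsLoxodromicBasis f e l) {P Q : Set V} (hP : IsOpen P)
    (hQ : IsOpen Q) (hPs : IsScaleInvariant 𝕜 P) (hQs : IsScaleInvariant 𝕜 Q)
    (hPQ : Disjoint P Q) (hfPQ : ∀ v, v ≠ 0 → v ∉ Q → f v ∈ P) :
    ∃ U W : Submodule 𝕜 V, IsCompl U W ∧ (∀ v ∈ U, v ≠ 0 → v ∈ P) ∧ ∀ v ∈ W, v ≠ 0 → v ∈ Q := by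
  have hfP : MapsTo f P P := fun v hv => by
    obtain rfl | hv0 := eq_or_ne v 0
    · simpa using hv
    · exact hfPQ v hv0 (hPQ.notMem_of_mem_left hv)
  have hfQ : MapsTo f Qᶜ Qᶜ := fun v hv => by
    obtain rfl | hv0 := eq_or_ne v 0
    · simpa using hv
    · exact hPQ.notMem_of_mem_left (hfPQ v hv0 hv)
  obtain ⟨g, hg, hfg⟩ := hf.exists_comp_eq_id
  have hgP : MapsTo g Pᶜ Pᶜ := fun v hv hgv =>
    hv (by simpa [← LinearMap.comp_apply, hfg] using hfP hgv)
  refine ⟨_, _, isCompl_span_image e {i | e i ∈ P}, fun v hv hv0 => ?_, fun v hv hv0 => ?_⟩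
  · by_contra hvP
    obtain ⟨i, hi, hi'⟩ :=
      hg.exists_mem_of_mem_span_image hP.isClosed_compl hPs.compl hgP hv hvP hv0
    exact hi' hi
  · by_contra hvQ
    obtain ⟨i, hi, hi'⟩ :=
      hf.exists_mem_of_mem_span_image hQ.isClosed_compl hQs.compl hfQ hv hvQ hv0
    have := hfPQ _ (e.ne_zero i) hi'
    rw [hf.apply_eq, hPs (hf.ne_zero i)] at this
    exact hi this

end IsLoxodromicBasis

end Dynamics

theorem isOpen_setOf_forall_notMem_apply_mem {𝕜 V : Type*} [RCLike 𝕜] [NormedAddCommGroup V]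
    [NormedSpace 𝕜 V] [FiniteDimensional 𝕜 V] {P Q : Set V} (hP : IsOpen P) (hQ : IsOpen Q)
    (hPs : IsScaleInvariant 𝕜 P) (hQs : IsScaleInvariant 𝕜 Q) :
    IsOpen {f : V →L[𝕜] V | ∀ v, v ≠ 0 → v ∉ Q → f v ∈ P} := by
  have : ProperSpace V := FiniteDimensional.proper 𝕜 V
  have hK : IsCompact (Metric.sphere 0 1 ∩ Qᶜ) :=
    (isCompact_sphere 0 1).inter_right hQ.isClosed_compl
  have hiff (f : V →L[𝕜] V) :
      (∀ v, v ≠ 0 → v ∉ Q → f v ∈ P) ↔ ∀ v ∈ Metric.sphere 0 1 ∩ Qᶜ, f v ∈ P := by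
    refine ⟨fun h v hv => h v (ne_zero_of_mem_unit_sphere ⟨v, hv.1⟩) hv.2, fun h v hv hvQ => ?_⟩
    have hc : (‖v‖⁻¹ : 𝕜) ≠ 0 := by simpa using hv
    have := h ((‖v‖⁻¹ : 𝕜) • v) ⟨by simp [norm_smul, hv], (hQs.compl hc v).2 hvQ⟩
    rwa [map_smul, hPs hc] at this
  simp only [hiff, isOpen_iff_eventually]
  refine fun f hf => hK.eventually_forall_of_forall_eventually fun v hv => ?_
  have hcont : Continuous fun z : (V →L[𝕜] V) × V => z.1 z.2 := by fun_prop
  exact hcont.continuousAt.eventually_mem (hP.mem_nhds (hf v hv))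

section DominatedSplitting

variable {V : Type*} [NormedAddCommGroup V] [NormedSpace ℂ V] [FiniteDimensional ℂ V]

theorem dense_setOf_exists_isLoxodromicBasis :
    Dense {f : V →L[ℂ] V | ∃ (e : Basis (Fin (finrank ℂ V)) ℂ V) (l : Fin (finrank ℂ V) → ℂ),
      IsLoxodromicBasis (f : End ℂ V) e l} := by
  intro f
  obtain ⟨a, ha⟩ := exists_forall_hasEigenvalue_add_smul (f : End ℂ V)
  -- Pushing `a i` radially with speed `i + 1` makes its modulus `‖a i‖ + t * (i + 1)`.
  choose u hu using fun i => exists_forall_norm_add_smul_eq (a i)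
  obtain ⟨D, hD⟩ := ha fun i => (i + 1) * u i
  let D' : V →L[ℂ] V := LinearMap.toContinuousLinearMap D
  let l (t : ℝ) (i : Fin (finrank ℂ V)) : ℂ := a i + t * ((i + 1) * u i)
  have hlim : Tendsto (fun t : ℝ => f + (t : ℂ) • D') (𝓝[>] 0) (𝓝 f) :=
    (Continuous.tendsto' (by fun_prop) 0 f (by simp)).mono_left nhdsWithin_le_nhds
  have hinj := (eventually_injective_add_mul (fun i => ‖a i‖) (d := fun i => (i : ℝ) + 1)
    (fun i j h => by simpa [Fin.ext_iff] using h) 0).filter_mono (nhdsGT_le_nhdsNE 0)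
  refine mem_closure_of_tendsto hlim ?_
  filter_upwards [hinj, self_mem_nhdsWithin] with t ht (htpos : 0 < t)
  have hnorm (i : Fin (finrank ℂ V)) : ‖l t i‖ = ‖a i‖ + t * (i + 1) := by
    rw [← hu i (t * (i + 1)) (by positivity)]
    simp [l, mul_assoc]
  have hl : Injective fun i => ‖l t i‖ := by simpa only [hnorm] using ht
  obtain ⟨e, he⟩ := exists_basis_hasEigenvector (by simp) hl.of_comp (hD t)
  exact ⟨e, l t, fun i => (he i).apply_eq_smul,
    fun i => norm_pos_iff.1 (by rw [hnorm]; positivity), hl⟩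

theorem exists_isCompl_forall_mem {P Q : Set V} (hP : IsOpen P) (hQ : IsOpen Q)
    (hPs : IsScaleInvariant ℂ P) (hQs : IsScaleInvariant ℂ Q) (hPQ : Disjoint P Q)
    {f : V →L[ℂ] V} (hf : ∀ v, v ≠ 0 → v ∉ Q → f v ∈ P) :
    ∃ U W : Submodule ℂ V, IsCompl U W ∧ (∀ v ∈ U, v ≠ 0 → v ∈ P) ∧ ∀ v ∈ W, v ≠ 0 → v ∈ Q := by
  obtain ⟨g, hg, e, l, hgl⟩ := dense_setOf_exists_isLoxodromicBasis.inter_open_nonempty _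
    (isOpen_setOf_forall_notMem_apply_mem hP hQ hPs hQs) ⟨f, hf⟩
  exact hgl.exists_isCompl_forall_mem hP hQ hPs hQs hPQ hg

end DominatedSplitting

namespace CProj

variable {m : ℕ}

/-- The set of nonzero vectors spanning a line in `X`. -/
def cone (X : Set (CProj m)) : Set (Fin (m + 1) → ℂ) :=
  {v | ∃ hv : v ≠ 0, Projectivization.mk ℂ v hv ∈ X}

theorem isScaleInvariant_cone (X : Set (CProj m)) : IsScaleInvariant ℂ (cone X) := by
  intro c hc v
  have hmk (hv : v ≠ 0) (hcv : c • v ≠ 0) :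
      Projectivization.mk ℂ (c • v) hcv = Projectivization.mk ℂ v hv :=
    (Projectivization.mk_eq_mk_iff' ..).2 ⟨c, rfl⟩
  simp +contextual [cone, hc, hmk]

theorem isOpen_cone {X : Set (CProj m)} (hX : IsOpen X) : IsOpen (cone X) := by
  have hpre : IsOpen ((fun v : {v : Fin (m + 1) → ℂ // v ≠ 0} =>
    Projectivization.mk ℂ v.1 v.2) ⁻¹' X) := isOpen_coinduced.1 hX
  convert! isOpen_ne.isOpenMap_subtype_val _ hpre
  ext v
  simp [cone]

theorem disjoint_cone {X Y : Set (CProj m)} (hXY : Disjoint X Y) : Disjoint (cone X) (cone Y) :=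
  disjoint_left.2 fun _ hX hY => hXY.notMem_of_mem_left hX.2 hY.2

theorem exists_linearEquiv_mem_cone_iff (γ : PSL(m + 1, ℂ)) :
    ∃ A : (Fin (m + 1) → ℂ) ≃ₗ[ℂ] (Fin (m + 1) → ℂ),
      ∀ X v, A v ∈ cone X ↔ v ∈ cone ((fun x : CProj m => γ • x) ⁻¹' X) := by
  obtain ⟨g, rfl⟩ := QuotientGroup.mk_surjective γ
  refine ⟨Matrix.SpecialLinearGroup.toLin' g, fun X v => ?_⟩
  exact ⟨fun ⟨h, hX⟩ => ⟨by simpa using h, hX⟩, fun ⟨h, hX⟩ => ⟨by simpa using h, hX⟩⟩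

theorem exists_finrank_add_finrank_eq_of_image_eq_compl {R S : Set (CProj m)} (hR : IsOpen R)
    (hRS : Disjoint (closure R) S) {γ : PSL(m + 1, ℂ)}
    (hγ : (fun x : CProj m => γ • x) '' R = Sᶜ) :
    ∃ U W : Submodule ℂ (Fin (m + 1) → ℂ), finrank ℂ U + finrank ℂ W = m + 1 ∧
      (∀ v ∈ U, v ≠ 0 → v ∈ cone S) ∧ ∀ v ∈ W, v ≠ 0 → v ∈ cone R := by
  -- The lift `A` of `γ` maps the complement of the cone of `R` into that of `S`, which is
  -- contained in the open cone of `(closure R)ᶜ`.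
  obtain ⟨A, hA⟩ := exists_linearEquiv_mem_cone_iff γ
  have hpre : (fun x : CProj m => γ • x) ⁻¹' S = Rᶜ := by
    rw [← compl_compl S, ← hγ, preimage_compl, preimage_image_eq _ (MulAction.injective γ)]
  have hAS (v) (hv : v ≠ 0) (hvR : v ∉ cone R) : A v ∈ cone S := by
    rw [hA, hpre]
    exact ⟨hv, fun h => hvR ⟨hv, h⟩⟩
  have hsub : cone S ⊆ cone (closure R)ᶜ := fun v ⟨hv, h⟩ => ⟨hv, hRS.notMem_of_mem_right h⟩
  have hdisj : Disjoint (cone (closure R)ᶜ) (cone R) :=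
    disjoint_cone (disjoint_compl_left.mono_right subset_closure)
  obtain ⟨U, W, hUW, hU, hW⟩ := exists_isCompl_forall_mem
    (isOpen_cone isClosed_closure.isOpen_compl) (isOpen_cone hR) (isScaleInvariant_cone _)
    (isScaleInvariant_cone _) hdisj (f := LinearMap.toContinuousLinearMap A.toLinearMap)
    fun v hv hvR => hsub (hAS v hv hvR)
  refine ⟨U.map A.toLinearMap, W, ?_, ?_, hW⟩
  · rw [LinearEquiv.finrank_map_eq, Submodule.finrank_add_eq_of_isCompl hUW, finrank_fin_fun]
  · rintro _ ⟨v, hv, rfl⟩ hAv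
    have hv0 : v ≠ 0 := by simpa using hAv
    exact hAS v hv0 (hdisj.notMem_of_mem_left (hU v hv hv0))

theorem finrank_add_finrank_le_of_disjoint {X Y : Set (CProj m)} (hXY : Disjoint X Y)
    {U W : Submodule ℂ (Fin (m + 1) → ℂ)} (hU : ∀ v ∈ U, v ≠ 0 → v ∈ cone X)
    (hW : ∀ v ∈ W, v ≠ 0 → v ∈ cone Y) : finrank ℂ U + finrank ℂ W ≤ m + 1 := by
  have hUW : Disjoint U W := Submodule.disjoint_def.2 fun v hvU hvW => by
    by_contra hv
    exact (disjoint_cone hXY).notMem_of_mem_left (hU v hvU hv) (hW v hvW hv)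
  simpa using Submodule.finrank_add_finrank_le_of_disjoint hUW

end CProj

theorem theorem1_general {m : ℕ} {Γ : Subgroup PSL(m + 1, ℂ)} (hΓ : IsSchottky Γ) : Odd m := by
  obtain ⟨g, hg, R, S, γ, hR, -, -, -, hRR, hSS, hRS, -, hγ⟩ := hΓ
  have : Nontrivial (Fin g) := Fin.nontrivial_iff_two_le.2 hg
  obtain ⟨i, j, hij⟩ := exists_pair_ne (Fin g)
  have key (k : Fin g) :=
    CProj.exists_finrank_add_finrank_eq_of_image_eq_compl (hR k) (hRS k k) (hγ k)
  obtain ⟨U, W, hUW, hU, hW⟩ := key i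
  obtain ⟨U', W', hUW', hU', hW'⟩ := key j
  have hRS' (k k') : Disjoint (R k) (closure (S k')) := (hRS k k').mono_left subset_closure
  have hRR' : Disjoint (R i) (R j) := (hRR i j hij).mono subset_closure subset_closure
  have hUU' := CProj.finrank_add_finrank_le_of_disjoint (hSS i j hij) hU hU'
  have hWW' := CProj.finrank_add_finrank_le_of_disjoint hRR' hW hW'
  have hWU' := CProj.finrank_add_finrank_le_of_disjoint (hRS' i j) hW hU'
  have hW'U := CProj.finrank_add_finrank_le_of_disjoint (hRS' j i) hW' hU
  exact ⟨finrank ℂ U - 1, by lia⟩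

theorem theorem1 (n : ℕ) (Γ : Subgroup PSL(2 * n + 1, ℂ)) (hΓ : DiscreteTopology Γ) :
    ¬ IsSchottky (m := 2 * n) Γ :=
  fun h => Nat.not_odd_iff_even.2 (even_two_mul n) (theorem1_general h)
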